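/- **Setting.** Fix an integer $b>1$ (the number of colours; write $b=\{0,\dots,b-1\}$). A digraph $G$ has a non-empty, possibly infinite vertex set $V(G)$ and an edge set $E(G)\subseteq V(G)\times V(G)$ (self-loops allowed). Put $\mathrm{Var}(x)=\{y:(x,y)\in E(G)\}$, $\mathrm{Cl}(x)=\{y:(y,x)\in E(G)\}$, $N(x)=\mathrm{Var}(x)\cup\mathrm{Cl}(x)$ and $\mathrm{maxdeg}(G)=\max_x|N(x)|$. Let $N(x,r)$ be the ball of radius $r$ around $x$ in the graph distance that ignores edge directions. Let $\mathrm{Rel}(G)$ be the digraph on $V(G)$ in which $(x,y)$ is an edge iff $\mathrm{Var}(x)\cap\mathrm{Var}(y)\neq\emptyset$. For integers $R\ge1$, $d\ge 0$ and real $\varepsilon>0$, let $\mathrm{subexp}(R,\varepsilon,d)$ be the class of digraphs $G$ with $\mathrm{maxdeg}(G)\le d$ and $|N(x,3R)|\le(1+\varepsilon)^R$ for all $x\in V(G)$. A Moser–Tardos tuple $\mathcal M=(G,\mathbf R,\pi)$ consists of a digraph $G$; a local rule $\mathbf R$, i.e. sets $\mathbf R(x)\subseteq b^{\mathrm{Var}(x)}$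 for $x\in V(G)$ with $\mathbf R(x)=b^{\mathrm{Var}(x)}$ whenever $\mathrm{Var}(x)=\emptyset$; and a partition $\pi$, i.e. a finite set of pairwise disjoint subsets of $V(G)$ with union $V(G)$. Write $\mathbf R^c(x)=b^{\mathrm{Var}(x)}\setminus\mathbf R(x)$, and let $S_\pi(x)\in\pi$ be the part containing $x$. The partition $\pi$ is $r$-sparse if for every $x$ the distinct points of $N(x,r)$ lie in distinct parts. For $f\in b^{V(G)}$ let $B(f)=\{x: f\restriction\mathrm{Var}(x)\in\mathbf R^c(x)\}$. A set of vertices is independent in a digraph if no two distinct elements of it are joined by an edge. An independence function on $\mathrm{Rel}(G)$ assigns to each $X\subseteq V(G)$ an inclusion-maximal subset of $X$ that is independent in $\mathrm{Rel}(G)$. **Algorithm.** Given $\mathtt{rnd}\in b^{\pi\times\mathbb N}$ and independence functions $I_0,I_1,\dots$ on $\mathrm{Rel}(G)$, which may depend on the time and on $\mathtt{rnd}$, put $MT^0(x)=\mathtt{rnd}(S_\pi(x),0)$, $h^0(x)=0$ and $h^1(x)=1$. For $j\ge0$ let $U_j=\bigcup_{y\in I_j(B(MT^j))}\mathrm{Var}(y)$.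 If $x\in U_j$, put $MT^{j+1}(x)=\mathtt{rnd}(S_\pi(x),h^{j+1}(x))$ and $h^{j+2}(x)=h^{j+1}(x)+1$; otherwise put $MT^{j+1}(x)=MT^j(x)$ and $h^{j+2}(x)=h^{j+1}(x)$. Let $h^\infty_{\mathcal M,\mathtt{rnd}}(x)=\lim_k h^k(x)\in\mathbb N\cup\{\infty\}$, the total number of resamplings of $x$ (the initial assignment counts as one). **Theorem 2.1.** For every integer $b>1$, real $\delta>0$ and integers $d,p\ge0$ there is a constant $K>0$, depending only on $b,\delta,d,p$, with the following property. Let $\mathcal M=(G,\mathbf R,\pi)$ be a Moser–Tardos tuple with $|\pi|=p$, let $\Delta=\mathrm{maxdeg}(\mathrm{Rel}(G))$, and let $R\ge1$ be an integer and $\varepsilon>0$ a real such that $G\in\mathrm{subexp}(R,\varepsilon,d)$, $\pi$ is $3R$-sparse, and $$\max_{x\in V(G)}\frac{|\mathbf R^c(x)|}{b^{|\mathrm{Var}(x)|}}\le\frac1{(\mathrm e\Delta)^{1+\delta}\,b^{\varepsilon d}}.$$ Then, for every choice of the independence functions and for every $m\in\mathbb N$, $$\Pr_{\mathtt{rnd}}\Big(\sup_{x\in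 V(G)}h^\infty_{\mathcal M,\mathtt{rnd}}(x)\ge m\Big)\le\frac{K(m+1)^{|\pi|}}{(\mathrm e\Delta)^{\delta m}},$$ where $\mathtt{rnd}$ is uniformly distributed on $b^{\pi\times\mathbb N}$, i.e. its entries are independent and uniform on $b$. (In the degenerate case $\Delta=0$, where $G$ has no edges, the right-hand sides are read with $0^0=1$ and $a/0=\infty$ for $a>0$. If the independence functions depend on $\mathtt{rnd}$ in a non-measurable way, $\Pr$ is read as outer probability.) -/

import Mathlib

open MeasureTheory Filter Topology

universe u

namespace MT

section Digraphs

variable {V : Type u} (G : Digraph V)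

/-- `Var(x)`: the out-neighbourhood of `x`. -/
def Var (x : V) : Set V := {y | G.Adj x y}

/-- `Cl(x)`: the in-neighbourhood of `x`. -/
def Cl (x : V) : Set V := {y | G.Adj y x}

/-- `N(x) = Var(x) ∪ Cl(x)`. -/
def nbhd (x : V) : Set V := Var G x ∪ Cl G x

/-- The maximal vertex degree `max_x |N(x)|`, as an extended natural number. -/
noncomputable def maxDeg : ℕ∞ := ⨆ x, (nbhd G x).encard

/-- `Rel(G)`: two (possibly equal) vertices are adjacent iff their out-neighbourhoods meet. -/
def Rel : Digraph V where
  Adj x y := (Var G x ∩ Var G y).Nonempty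

/-- The ball of radius `r` around `x`, for the graph distance in which edges of `G` may be traversed
in either direction. -/
def ball (x : V) (r : ℕ) : Set V := {y | G.toSimpleGraphInclusive.edist x y ≤ r}

/-- The class of digraphs with maximal degree at most `d` such that every ball of radius `3R` has at
most `(1+ε)^R` vertices. (All balls are finite when the degrees are at most `d`.) -/
def IsSubexp (R : ℕ) (ε : ℝ) (d : ℕ) : Prop :=
  maxDeg G ≤ d ∧
    ∀ x, (ball G x (3 * R)).Finite ∧ ((ball G x (3 * R)).ncard : ℝ) ≤ (1 + ε) ^ R

/-- No two distinct elements of `I` are joined by an edge (self-loops are ignored). -/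
def IsIndependent (I : Set V) : Prop := ∀ x ∈ I, ∀ y ∈ I, x ≠ y → ¬ G.Adj x y

/-- An independence function assigns to each set of vertices one of its (inclusion-)maximal
independent subsets. -/
structure IndependenceFunction where
  toFun : Set V → Set V
  maximal : ∀ X, Maximal (fun Y => Y ⊆ X ∧ IsIndependent G Y) (toFun X)

/-- A local rule with `b` colours: each vertex `x` carries a set of allowed colourings of `Var(x)`,
and it carries no constraint if `Var(x)` is empty. -/
structure LocalRule (b : ℕ) where
  allowed : ∀ x, Set (Var G x → Fin b)
  allowed_of_empty : ∀ x, Var G x = ∅ → allowed x = Set.univ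

variable {G}

/-- The bad set of `f`: the clauses violated by `f`. -/
def LocalRule.bad {b : ℕ} (R : LocalRule G b) (f : V → Fin b) : Set V :=
  {x | (fun y : Var G x => f y) ∈ (R.allowed x)ᶜ}

/-- `|Rᶜ(x)| / b ^ |Var(x)|`: the probability that a uniformly random colouring violates `x`. -/
noncomputable def LocalRule.violationProb {b : ℕ} (R : LocalRule G b) (x : V) : ℝ :=
  ((R.allowed x)ᶜ.ncard : ℝ) / (b : ℝ) ^ (Var G x).ncard

end Digraphs

/-- A partition of `V`: a finite set of pairwise disjoint subsets with union `V`. -/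
structure VertexPartition (V : Type u) where
  parts : Finset (Set V)
  pairwiseDisjoint : ∀ A ∈ parts, ∀ B ∈ parts, A ≠ B → Disjoint A B
  exists_mem : ∀ x, ∃ A ∈ parts, x ∈ A

namespace VertexPartition

variable {V : Type u} (π : VertexPartition V)

/-- `S_π(x)`: the part of `π` that contains `x`. -/
noncomputable def part (x : V) : π.parts :=
  ⟨(π.exists_mem x).choose, (π.exists_mem x).choose_spec.1⟩

theorem mem_part (x : V) : x ∈ (π.part x : Set V) := (π.exists_mem x).choose_spec.2

theorem part_eq_iff (x : V) (A : π.parts) : π.part x = A ↔ x ∈ (A : Set V) := by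
  constructor
  · rintro rfl
    exact π.mem_part x
  · intro h
    by_contra hne
    exact Set.disjoint_left.1
      (π.pairwiseDisjoint _ (π.part x).2 _ A.2 (fun h' => hne (Subtype.ext h')))
      (π.mem_part x) h

/-- `π` is `r`-sparse: different points of a ball of radius `r` lie in different parts. -/
def IsSparse (G : Digraph V) (r : ℕ) : Prop := ∀ x, Set.InjOn π.part (ball G x r)

end VertexPartition

/-- A Moser-Tardos tuple `(G, R, π)` with `b` colours. -/
structure Tuple (V : Type u) (b : ℕ) where
  graph : Digraph V
  rule : LocalRule graph b
  partition : VertexPartition V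

namespace Tuple

variable {V : Type u} {b : ℕ} (M : Tuple V b)

/-- The sources of randomness `b^{π × ℕ}`: one stream of colours for each part of `π`. -/
abbrev Source : Type u := M.partition.parts × ℕ → Fin b

/-- The law of the random source: all entries are independent and uniform on the `b` colours. -/
noncomputable def sourceMeasure : Measure M.Source :=
  Measure.infinitePi fun _ => ProbabilityTheory.uniformOn (Set.univ : Set (Fin b))

theorem isProbabilityMeasure_sourceMeasure (hb : 1 < b) :
    IsProbabilityMeasure M.sourceMeasure := by
  have : Nonempty (Fin b) := ⟨⟨0, by omega⟩⟩
  have := ProbabilityTheory.isProbabilityMeasure_uniformOn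
    (Set.finite_univ : (Set.univ : Set (Fin b)).Finite) Set.univ_nonempty
  unfold sourceMeasure
  infer_instance

variable (I : ℕ → IndependenceFunction (Rel M.graph)) (rnd : M.Source)

/-- The variables that are resampled at time `j` when the current colouring is `f`, namely
`Var(I_j(B(f)))`; the independence function is allowed to depend on the time `j`. -/
def resampled (j : ℕ) (f : V → Fin b) : Set V :=
  ⋃ y ∈ (I j).toFun (M.rule.bad f), Var M.graph y

open Classical in
/-- The pair `(MT^j, h^{j+1})`. -/
noncomputable def state : ℕ → (V → Fin b) × (V → ℕ)
  | 0 => (fun x => rnd (M.partition.part x, 0), fun _ => 1)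
  | j + 1 =>
    let f := (state j).1
    let h := (state j).2
    (fun x => if x ∈ M.resampled I j f then rnd (M.partition.part x, h x) else f x,
      fun x => if x ∈ M.resampled I j f then h x + 1 else h x)

/-- The colouring `MT^j` produced by the algorithm. -/
noncomputable def col (j : ℕ) : V → Fin b := (M.state I rnd j).1

/-- `h^j(x)`: the number of times `x` was resampled when `MT^0, …, MT^{j-1}` were defined. -/
noncomputable def count : ℕ → V → ℕ
  | 0 => fun _ => 0
  | j + 1 => (M.state I rnd j).2

theorem col_zero (x : V) : M.col I rnd 0 x = rnd (M.partition.part x, 0) := rfl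

theorem count_zero (x : V) : M.count I rnd 0 x = 0 := rfl

theorem count_one (x : V) : M.count I rnd 1 x = 1 := rfl

open Classical in
theorem col_succ (j : ℕ) (x : V) : M.col I rnd (j + 1) x =
    if x ∈ M.resampled I j (M.col I rnd j)
    then rnd (M.partition.part x, M.count I rnd (j + 1) x) else M.col I rnd j x := rfl

open Classical in
theorem count_succ_succ (j : ℕ) (x : V) : M.count I rnd (j + 2) x =
    if x ∈ M.resampled I j (M.col I rnd j)
    then M.count I rnd (j + 1) x + 1 else M.count I rnd (j + 1) x := rfl

theorem count_mono (x : V) : Monotone fun j => M.count I rnd j x := by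
  refine monotone_nat_of_le_succ fun j => ?_
  cases j with
  | zero => exact Nat.zero_le _
  | succ j =>
    rw [count_succ_succ]
    split_ifs <;> omega

/-- `h^∞(x)`: the total number of resamplings of `x`. The sequence `h^j(x)` is nondecreasing in `j`,
so this supremum is its limit. -/
noncomputable def totalCount (x : V) : ℕ∞ := ⨆ j, (M.count I rnd j x : ℕ∞)

theorem tendsto_count (x : V) :
    Tendsto (fun j => (M.count I rnd j x : ℕ∞)) atTop (𝓝 (M.totalCount I rnd x)) :=
  tendsto_atTop_iSup fun _ _ h => Nat.cast_le.2 (M.count_mono I rnd x h)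

end Tuple

end MT

/-! Stop the algorithm at the first moment when some vertex `x` has been sampled `m` times. No
vertex has then been sampled more often, and the ball of radius `3R` around `x` is small. So the
total resampling count (the initial sampling excluded) over the ball of radius `3i` cannot grow by
more than a factor `1 + ε` for every `i < R`. For some `i`, the ball `A` of radius `3i` thus sees
little resampling in the shell around it, compared with its inside.

Log only the resampled clauses with a variable in `A`, and ask of each only that the colours on `A`
extend to a violation. This costs a factor `b` per variable outside `A`, in total at most `b ^ (ε
d)` per log entry: exactly what the hypothesis allows for (`exists_legal_of_le_totalCount`).

Parts separate the points of the `3R`-ball, so log entries read fresh independent cells, and a log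
of length `n` has probability at most `(eΔ) ^ (-(1+δ)n)`. Logs that differ by exchanging clauses
without common variables are legal for the same tables, so only layered normal forms are summed.
Their generating function at `1/(eΔ)` is at most `2 ^ p` (`sum_layerings_le`), and `n ≥ m - 1` turns
the remaining `(eΔ) ^ (-δn)` into the decay in `m`.

With vertices labelled by parts, the number of window shapes is bounded in terms of `b, d, p`, so a
union bound finishes even for infinite graphs. The events in it do not mention the independence
functions, which may therefore depend on `rnd`. -/

namespace MT

/-! ### Words up to commutation, their layered normal forms and the count of these -/

section Traces

variable {C : Type*} {r : C → C → Prop}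

/-- Words that differ by exchanging neighbouring letters that are not related by `r`. -/
inductive TraceEquiv (r : C → C → Prop) : List C → List C → Prop
  | refl (l) : TraceEquiv r l l
  | swap (a b l) : ¬ r a b → TraceEquiv r (a :: b :: l) (b :: a :: l)
  | cons (a) {l l'} : TraceEquiv r l l' → TraceEquiv r (a :: l) (a :: l')
  | trans {l l' l''} : TraceEquiv r l l' → TraceEquiv r l' l'' → TraceEquiv r l l''

namespace TraceEquiv

theorem perm {l l' : List C} (h : TraceEquiv r l l') : l.Perm l' := by
  induction h with
  | refl l => exact List.Perm.refl l
  | swap a b l _ => exact List.Perm.swap b a l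
  | cons a _ ih => exact ih.cons a
  | trans _ _ ih ih' => exact ih.trans ih'

theorem append_right {l l' : List C} (h : TraceEquiv r l l') (s : List C) :
    TraceEquiv r (l ++ s) (l' ++ s) := by
  induction h with
  | refl l => exact refl _
  | swap a b l h => exact swap a b _ h
  | cons a _ ih => exact ih.cons a
  | trans _ _ ih ih' => exact ih.trans ih'

theorem append_left {l l' : List C} (h : TraceEquiv r l l') (s : List C) :
    TraceEquiv r (s ++ l) (s ++ l') := by
  induction s with
  | nil => exact h
  | cons a s ih => exact ih.cons a

theorem append_singleton {l : List C} {c : C} (h : ∀ x ∈ l, ¬ r x c) :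
    TraceEquiv r (l ++ [c]) (c :: l) := by
  induction l with
  | nil => exact refl _
  | cons a l ih =>
    exact ((ih fun x hx => h x (List.mem_cons_of_mem a hx)).cons a).trans
      (swap a c l (h a List.mem_cons_self))

theorem of_perm [Std.Symm r] {l l' : List C} (h : l.Perm l')
    (hl : l.Pairwise fun a b => ¬ r a b) : TraceEquiv r l l' := by
  have hsymm : ∀ {a b : C}, ¬ r a b → ¬ r b a := fun h h' => h (Std.Symm.symm _ _ h')
  induction h with
  | nil => exact refl _
  | cons a _ ih => exact (ih (List.pairwise_cons.1 hl).2).cons a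
  | swap a b l => exact swap b a l ((List.pairwise_cons.1 hl).1 a List.mem_cons_self)
  | trans h₁ _ ih ih' => exact (ih hl).trans (ih' (h₁.pairwise hl hsymm))

end TraceEquiv

/-- The concatenation of the layers. -/
noncomputable def word (S : List (Finset C)) : List C := S.flatMap Finset.toList

@[simp]
theorem word_nil : word ([] : List (Finset C)) = [] := rfl

@[simp]
theorem word_cons (T : Finset C) (S : List (Finset C)) : word (T :: S) = T.toList ++ word S := by
  simp [word]

variable [Fintype C]

/-- The elements that are `r`-related to some element of `T`. -/
noncomputable def reach (r : C → C → Prop) (T : Finset C) : Finset C := by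
  classical exact Finset.univ.filter fun c => ∃ a ∈ T, r a c

@[simp]
theorem mem_reach {T : Finset C} {c : C} : c ∈ reach r T ↔ ∃ a ∈ T, r a c := by
  simp [reach]

theorem card_reach_le {Δ : ℕ} (hΔ : ∀ a, (reach r {a}).card ≤ Δ) (T : Finset C) :
    (reach r T).card ≤ Δ * T.card := by
  classical
  have : reach r T ⊆ T.biUnion fun a => reach r {a} := fun c hc => by simpa using hc
  calc (reach r T).card ≤ _ := Finset.card_le_card this
    _ ≤ T.card * Δ := Finset.card_biUnion_le_card_mul _ _ _ fun a _ => hΔ a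
    _ = Δ * T.card := mul_comm _ _

/-- Sequences of non-empty `r`-independent sets, the first contained in `X` and each of the others
contained in the set of elements related to its predecessor. -/
def IsLayered (r : C → C → Prop) : Finset C → List (Finset C) → Prop
  | _, [] => True
  | X, T :: S => T ⊆ X ∧ T.Nonempty ∧ (T.toList.Pairwise fun a b => ¬ r a b) ∧
      IsLayered r (reach r T) S

theorem IsLayered.mono {X Y : Finset C} (h : X ⊆ Y) {S : List (Finset C)}
    (hS : IsLayered r X S) : IsLayered r Y S := by
  cases S with
  | nil => trivial
  | cons T S => exact ⟨hS.1.trans h, hS.2⟩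

/-- The letter `c` commutes to the left until it meets a layer with an element related to it, and
joins the layer just after that one (or forms a new last layer). If no layer stops it, it joins the
first. Enlarging a layer only enlarges its `reach`, so the later layers stay admissible. -/
theorem IsLayered.exists_append [Std.Refl r] [Std.Symm r] {X : Finset C} {S : List (Finset C)}
    (hS : IsLayered r X S) {c : C} (hc : c ∈ X ∨ ∃ x ∈ word S, r x c) :
    ∃ S', IsLayered r X S' ∧ TraceEquiv r (word S ++ [c]) (word S') := by
  classical
  induction S generalizing X with
  | nil =>
    refine ⟨[{c}], ⟨?_, by simp, by simp, trivial⟩, ?_⟩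
    · simpa using hc
    · simpa using TraceEquiv.refl _
  | cons T S ih =>
    obtain ⟨hTX, hT, hTr, hS⟩ := hS
    by_cases hx : ∃ x ∈ word (T :: S), r x c
    · obtain ⟨S', hS', h⟩ := ih hS (by
        obtain ⟨x, hx, hxc⟩ := hx
        rw [word_cons, List.mem_append, Finset.mem_toList] at hx
        rcases hx with hx | hx
        · exact Or.inl (mem_reach.2 ⟨x, hx, hxc⟩)
        · exact Or.inr ⟨x, hx, hxc⟩)
      refine ⟨T :: S', ⟨hTX, hT, hTr, hS'⟩, ?_⟩
      rw [word_cons, word_cons, List.append_assoc]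
      exact h.append_left _
    · have hcX := hc.resolve_right hx
      push Not at hx
      have hxT : ∀ x ∈ T, ¬ r x c := fun x hx' => hx x (by simp [hx'])
      have hcT : c ∉ T := fun h => hxT c h (Std.Refl.refl c)
      have hperm : (T.toList ++ [c]).Perm (insert c T).toList :=
        (List.perm_append_comm).trans (Finset.toList_insert hcT).symm
      have hpair : (T.toList ++ [c]).Pairwise fun a b => ¬ r a b := by
        rw [List.pairwise_append]
        refine ⟨hTr, by simp, fun a ha b hb => ?_⟩
        rw [List.mem_singleton.1 hb]
        exact hxT a (Finset.mem_toList.1 ha)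
      refine ⟨insert c T :: S, ⟨Finset.insert_subset hcX hTX, by simp, ?_, ?_⟩, ?_⟩
      · exact hperm.pairwise hpair fun h h' => h (Std.Symm.symm _ _ h')
      · refine hS.mono fun a ha => ?_
        obtain ⟨x, hx, hxa⟩ := mem_reach.1 ha
        exact mem_reach.2 ⟨x, Finset.mem_insert_of_mem hx, hxa⟩
      · rw [word_cons, word_cons, List.append_assoc]
        refine ((TraceEquiv.append_singleton fun x hx' =>
          hx x (by simp [hx'])).append_left T.toList).trans ?_
        have := (TraceEquiv.of_perm hperm hpair).append_right (word S)
        rwa [List.append_assoc, List.singleton_append] at this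

theorem exists_isLayered [Std.Refl r] [Std.Symm r] (L : List C) :
    ∃ S, IsLayered r Finset.univ S ∧ TraceEquiv r L (word S) := by
  induction L using List.reverseRecOn with
  | nil => exact ⟨[], trivial, TraceEquiv.refl _⟩
  | append_singleton L c ih =>
    obtain ⟨S, hS, h⟩ := ih
    obtain ⟨S', hS', h'⟩ := hS.exists_append (c := c) (Or.inl (Finset.mem_univ c))
    exact ⟨S', hS', (h.append_right [c]).trans h'⟩

open Classical in
/-- A finite set that contains all layered sequences with at most `k` layers. -/
noncomputable def layerings (r : C → C → Prop) : ℕ → Finset C → Finset (List (Finset C))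
  | 0, _ => {[]}
  | k + 1, X => insert [] <| (X.powerset.erase ∅).biUnion fun T =>
      (layerings r k (reach r T)).image (List.cons T)

theorem IsLayered.mem_layerings {X : Finset C} {S : List (Finset C)} (hS : IsLayered r X S)
    {k : ℕ} (hk : S.length ≤ k) : S ∈ layerings r k X := by
  induction S generalizing X k with
  | nil => cases k <;> simp [layerings]
  | cons T S ih =>
    cases k with
    | zero => simp at hk
    | succ k =>
      have := ih hS.2.2.2 (Nat.le_of_succ_le_succ hk)
      simp [layerings, this, hS.1, hS.2.1.ne_empty]

/-- Sequences with first layer `T` contribute at most `z^|T| (1+t)^(Δ|T|) ≤ t^|T|` by induction.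
Summing over `T ⊆ X` gives `(1+t)^|X|`, where the term `T = ∅` accounts for the empty sequence. -/
theorem sum_layerings_le {Δ : ℕ} (hΔ : ∀ a, (reach r {a}).card ≤ Δ) {z t : ℝ} (hz : 0 ≤ z)
    (ht : 0 ≤ t) (hzt : z * (1 + t) ^ Δ ≤ t) (k : ℕ) (X : Finset C) :
    ∑ S ∈ layerings r k X, z ^ (word S).length ≤ (1 + t) ^ X.card := by
  classical
  induction k generalizing X with
  | zero => simpa [layerings] using one_le_pow₀ (le_add_of_nonneg_right ht)
  | succ k ih =>
    rw [layerings, Finset.sum_insert (by simp)]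
    have key : ∀ T : Finset C,
        ∑ S ∈ (layerings r k (reach r T)).image (List.cons T), z ^ (word S).length ≤
          t ^ T.card := fun T => by
      rw [Finset.sum_image fun _ _ _ _ h => (List.cons.inj h).2]
      calc ∑ S ∈ layerings r k (reach r T), z ^ (word (T :: S)).length
          = z ^ T.card * ∑ S ∈ layerings r k (reach r T), z ^ (word S).length := by
            simp [Finset.mul_sum, pow_add]
        _ ≤ z ^ T.card * (1 + t) ^ (Δ * T.card) := by
            gcongr
            refine (ih _).trans (pow_le_pow_right₀ (le_add_of_nonneg_right ht)
              (card_reach_le hΔ T))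
        _ = (z * (1 + t) ^ Δ) ^ T.card := by rw [mul_pow, pow_mul]
        _ ≤ t ^ T.card := by gcongr
    calc z ^ (word ([] : List (Finset C))).length + _
        ≤ 1 + ∑ T ∈ X.powerset.erase ∅, t ^ T.card := by
          gcongr
          · simp
          · rw [Finset.sum_biUnion]
            · exact Finset.sum_le_sum fun T _ => key T
            · intro T _ T' _ hTT'
              refine Finset.disjoint_left.2 fun S hS hS' => hTT' ?_
              obtain ⟨_, _, rfl⟩ := Finset.mem_image.1 hS
              obtain ⟨_, _, h⟩ := Finset.mem_image.1 hS'
              exact (List.cons.inj h).1.symm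
      _ = ∑ T ∈ X.powerset, t ^ T.card := by
          rw [← Finset.add_sum_erase _ _ (Finset.empty_mem_powerset X)]
          simp
      _ = (1 + t) ^ X.card := by
          rw [add_comm, ← Finset.sum_pow_mul_eq_add_pow]
          simp

end Traces

/-! ### Legal logs for a random table and their probabilities -/

section Logs

variable {P C : Type*} {b : ℕ}

/-- The number of letters of `L` whose set of variables contains `y`. -/
noncomputable def height (v : C → Finset P) (L : List C) (y : P) : ℕ := by
  classical exact L.countP fun c => y ∈ v c

@[simp]
theorem height_nil (v : C → Finset P) (y : P) : height v [] y = 0 := by simp [height]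

open Classical in
theorem height_cons (v : C → Finset P) (c : C) (L : List C) (y : P) :
    height v (c :: L) y = height v L y + if y ∈ v c then 1 else 0 := by
  simp [height, List.countP_cons]

theorem height_le_length (v : C → Finset P) (L : List C) (y : P) : height v L y ≤ L.length :=
  List.countP_le_length

theorem height_perm {v : C → Finset P} {L L' : List C} (h : L.Perm L') (y : P) :
    height v L y = height v L' y := h.countP_eq _

theorem sum_height [Fintype P] (v : C → Finset P) (L : List C) :
    ∑ y, height v L y = (L.map fun c => (v c).card).sum := by
  classical
  induction L with
  | nil => simp
  | cons c L ih =>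
    simp only [height_cons, Finset.sum_add_distrib, ih, List.map_cons, List.sum_cons]
    simp [add_comm]

/-- A word of clauses, the latest one first, is a legal log for the table `ω` if, whenever a
clause `c` is added, the current colours of all the parts form an element of `F c`. -/
def Legal (v : C → Finset P) (F : C → Finset (P → Fin b)) (ω : P × ℕ → Fin b) : List C → Prop
  | [] => True
  | c :: L => Legal v F ω L ∧ (fun y => ω (y, height v L y)) ∈ F c

/-- Unrelated clauses have disjoint variables, so neither changes the heights at which the other
reads the table. -/
theorem Legal.of_traceEquiv {v : C → Finset P} {F : C → Finset (P → Fin b)} {r : C → C → Prop}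
    (hr : ∀ c c', ¬ r c c' → Disjoint (v c) (v c'))
    (hF : ∀ c g g', (∀ y ∈ v c, g y = g' y) → g ∈ F c → g' ∈ F c) {ω : P × ℕ → Fin b}
    {L L' : List C} (h : TraceEquiv r L L') (hL : Legal v F ω L) : Legal v F ω L' := by
  classical
  induction h with
  | refl l => exact hL
  | swap a c l h =>
    obtain ⟨⟨hl, hc⟩, ha⟩ := hL
    have hd := hr a c h
    refine ⟨⟨hl, hF _ _ _ (fun y hy => ?_) ha⟩, hF _ _ _ (fun y hy => ?_) hc⟩
    · rw [height_cons, if_neg (Finset.disjoint_left.1 hd hy), add_zero]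
    · rw [height_cons, if_neg (Finset.disjoint_right.1 hd hy), add_zero]
  | cons a h ih =>
    refine ⟨ih hL.1, ?_⟩
    simpa only [height_perm h.perm] using hL.2
  | trans _ _ ih ih' => exact ih' (ih hL)

theorem Legal.congr {v : C → Finset P} {F : C → Finset (P → Fin b)} {ω ω' : P × ℕ → Fin b}
    {L : List C} (h : ∀ y, ∀ i < height v L y, ω (y, i) = ω' (y, i))
    (hF : ∀ c g g', (∀ y ∈ v c, g y = g' y) → g ∈ F c → g' ∈ F c)
    (hL : Legal v F ω L) : Legal v F ω' L := by
  classical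
  induction L with
  | nil => trivial
  | cons c L ih =>
    refine ⟨ih (fun y i hi => h y i ?_) hL.1, hF _ _ _ (fun y hy => h y _ ?_) hL.2⟩
    · rw [height_cons]; omega
    · rw [height_cons, if_pos hy]; omega

/-- The law of a table of independent uniform colours. -/
noncomputable def tableMeasure (P : Type*) (b : ℕ) : Measure (P × ℕ → Fin b) :=
  Measure.infinitePi fun _ => ProbabilityTheory.uniformOn (Set.univ : Set (Fin b))

instance [NeZero b] : IsProbabilityMeasure (ProbabilityTheory.uniformOn (Set.univ : Set (Fin b))) :=
  ProbabilityTheory.isProbabilityMeasure_uniformOn Set.finite_univ Set.univ_nonempty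

instance [NeZero b] : IsProbabilityMeasure (tableMeasure P b) := by
  unfold tableMeasure
  infer_instance

theorem tableMeasure_slice [Fintype P] [NeZero b] (H : P → ℕ) (F : Finset (P → Fin b)) :
    (tableMeasure P b).real {ω | (fun y => ω (y, H y)) ∈ F} =
      (F.card : ℝ) / (b : ℝ) ^ Fintype.card P := by
  have hinj : Function.Injective fun y => (y, H y) := fun y y' h => (Prod.ext_iff.1 h).1
  have hmap := Measure.map_infinitePi_infinitePi_of_inj
    (P := fun _ : P × ℕ => ProbabilityTheory.uniformOn (Set.univ : Set (Fin b))) hinj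
  have hmeas : Measurable fun (ω : P × ℕ → Fin b) y => ω (y, H y) := by fun_prop
  have h1 : (tableMeasure P b).real {ω | (fun y => ω (y, H y)) ∈ F} =
      (Measure.infinitePi fun _ : P =>
        ProbabilityTheory.uniformOn (Set.univ : Set (Fin b))).real (F : Set (P → Fin b)) := by
    rw [← hmap, map_measureReal_apply hmeas F.measurableSet]
    rfl
  rw [h1, ← sum_measureReal_singleton]
  have h2 : ∀ g : P → Fin b, (Measure.infinitePi fun _ : P =>
      ProbabilityTheory.uniformOn (Set.univ : Set (Fin b))).real {g} =
      1 / (b : ℝ) ^ Fintype.card P := fun g => by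
    rw [Measure.real, Measure.infinitePi_singleton_of_fintype]
    simp [ProbabilityTheory.uniformOn_univ, ENNReal.toReal_inv]
  rw [Finset.sum_congr rfl fun g _ => h2 g]
  simp [div_eq_mul_inv]

/-- Legality of `L` depends only on the cells strictly below its heights, while the next clause
reads the cells exactly at these heights. The two events are independent, and the probabilities
multiply. -/
theorem tableMeasure_legal_le [Fintype P] [NeZero b] {v : C → Finset P}
    {F : C → Finset (P → Fin b)}
    (hF : ∀ c g g', (∀ y ∈ v c, g y = g' y) → g ∈ F c → g' ∈ F c) (L : List C) :
    (tableMeasure P b).real {ω | Legal v F ω L} ≤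
      (L.map fun c => ((F c).card : ℝ) / (b : ℝ) ^ Fintype.card P).prod := by
  classical
  induction L with
  | nil => simp [Legal]
  | cons c L ih =>
    let S : Finset (P × ℕ) := Finset.univ.biUnion fun y =>
      (Finset.range (height v L y)).image fun i => (y, i)
    let T : Finset (P × ℕ) := Finset.univ.image fun y => (y, height v L y)
    have hS : ∀ y i, (y, i) ∈ S ↔ i < height v L y := by simp [S]
    have hT : ∀ y, (y, height v L y) ∈ T := by simp [T]
    have hST : Disjoint S T := by
      refine Finset.disjoint_left.2 fun ⟨y, i⟩ h h' => ?_
      rw [hS] at h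
      simp only [T, Finset.mem_image, Finset.mem_univ, true_and, Prod.mk.injEq] at h'
      obtain ⟨_, rfl, rfl⟩ := h'
      exact lt_irrefl _ h
    have hind : ProbabilityTheory.iIndepFun (fun (i : P × ℕ) (ω : P × ℕ → Fin b) => ω i)
        (tableMeasure P b) :=
      ProbabilityTheory.iIndepFun_infinitePi (X := fun _ ω => ω) fun _ => measurable_id
    have hind' := hind.indepFun_finset S T hST fun i => measurable_pi_apply i
    let A : Set (S → Fin b) := {g | ∃ ω, Legal v F ω L ∧ (fun i : S => ω i) = g}
    let B : Set (T → Fin b) := {g | (fun y => g ⟨_, hT y⟩) ∈ F c}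
    -- `Legal.congr` shows that the event is determined by the cells in `S`.
    have hA : {ω | Legal v F ω L} = (fun (ω : P × ℕ → Fin b) (i : S) => ω i) ⁻¹' A := by
      ext ω
      refine ⟨fun h => ⟨ω, h, rfl⟩, fun ⟨ω', h, h'⟩ => h.congr (fun y i hi => ?_) hF⟩
      exact congrFun h' ⟨(y, i), (hS y i).2 hi⟩
    have hB : {ω : P × ℕ → Fin b | (fun y => ω (y, height v L y)) ∈ F c} =
        (fun (ω : P × ℕ → Fin b) (i : T) => ω i) ⁻¹' B := rfl
    have hAB := congrArg ENNReal.toReal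
      (ProbabilityTheory.IndepFun.measure_inter_preimage_eq_mul hind' A B
        (Set.toFinite A).measurableSet (Set.toFinite B).measurableSet)
    rw [ENNReal.toReal_mul, ← hA, ← hB, ← measureReal_def, ← measureReal_def, ← measureReal_def,
      tableMeasure_slice] at hAB
    have : {ω | Legal v F ω (c :: L)} = {ω | Legal v F ω L} ∩
      {ω : P × ℕ → Fin b | (fun y => ω (y, height v L y)) ∈ F c} := rfl
    rw [this, hAB, List.map_cons, List.prod_cons, mul_comm]
    gcongr

/-- The boundary losses `β ^ k` are cancelled on average by the factors `β ^ θ`. Of the remaining `ρ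
^ (-(1+δ))` per letter, `ρ⁻¹` is kept to sum over words and `ρ ^ (-δ)` gives the decay in `m`. -/
theorem prod_weight_le {ρ β δ θ : ℝ} (hρ : 1 ≤ ρ) (hβ : 1 ≤ β) (hδ : 0 ≤ δ) {a : C → ℝ}
    {k : C → ℕ} (ha₀ : ∀ c, 0 ≤ a c) (ha : ∀ c, a c ≤ 1 / (ρ ^ (1 + δ) * β ^ θ) * β ^ k c)
    {m : ℕ} {L : List C} (hm : m ≤ L.length + 1) (hk : ((L.map k).sum : ℝ) ≤ θ * L.length) :
    (L.map a).prod ≤ ρ ^ (δ * (1 - m)) * (1 / ρ) ^ L.length := by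
  have hρ₀ : 0 < ρ := one_pos.trans_le hρ
  have hβ₀ : 0 < β := one_pos.trans_le hβ
  have h1 : ∀ L : List C,
      (L.map a).prod ≤ (1 / (ρ ^ (1 + δ) * β ^ θ)) ^ L.length * β ^ (L.map k).sum := by
    intro L
    induction L with
    | nil => simp
    | cons c L ih =>
      have h0 : 0 ≤ (L.map a).prod := List.prod_nonneg fun x hx => by
        obtain ⟨c, _, rfl⟩ := List.mem_map.1 hx
        exact ha₀ c
      calc ((c :: L).map a).prod = a c * (L.map a).prod := by simp
        _ ≤ _ := mul_le_mul (ha c) ih h0 (by positivity)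
        _ = _ := by simp only [List.map_cons, List.sum_cons, List.length_cons]; ring
  have h2 : (β : ℝ) ^ (L.map k).sum ≤ (β ^ θ) ^ L.length := by
    rw [← Real.rpow_natCast, ← Real.rpow_mul_natCast hβ₀.le]
    exact Real.rpow_le_rpow_of_exponent_le hβ hk
  calc (L.map a).prod ≤ _ := h1 L
    _ ≤ (1 / (ρ ^ (1 + δ) * β ^ θ)) ^ L.length * (β ^ θ) ^ L.length := by gcongr
    _ = (ρ ^ (-δ)) ^ L.length * (1 / ρ) ^ L.length := by
      rw [← mul_pow, ← mul_pow, Real.rpow_add hρ₀, Real.rpow_one, Real.rpow_neg hρ₀.le]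
      congr 1
      have := (Real.rpow_pos_of_pos hβ₀ θ).ne'
      have := (Real.rpow_pos_of_pos hρ₀ δ).ne'
      field_simp
    _ ≤ ρ ^ (δ * (1 - m)) * (1 / ρ) ^ L.length := by
      gcongr
      rw [← Real.rpow_mul_natCast hρ₀.le]
      refine Real.rpow_le_rpow_of_exponent_le hρ ?_
      have : (m : ℝ) ≤ L.length + 1 := by exact_mod_cast hm
      nlinarith

theorem tableMeasure_exists_legal_le [Fintype P] [Fintype C] [NeZero b] {v : C → Finset P}
    {F : C → Finset (P → Fin b)} {r : C → C → Prop} [Std.Refl r] [Std.Symm r]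
    (hr : ∀ c c', ¬ r c c' → Disjoint (v c) (v c'))
    (hF : ∀ c g g', (∀ y ∈ v c, g y = g' y) → g ∈ F c → g' ∈ F c) {Δ : ℕ} (hΔ₀ : 0 < Δ)
    (hΔ : ∀ a, (reach r {a}).card ≤ Δ) {k : C → ℕ} {δ θ : ℝ} (hδ : 0 ≤ δ)
    (hq : ∀ c, ((F c).card : ℝ) / (b : ℝ) ^ Fintype.card P ≤
      1 / ((Real.exp 1 * Δ) ^ (1 + δ) * (b : ℝ) ^ θ) * (b : ℝ) ^ k c) (m : ℕ) :
    tableMeasure P b {ω | ∃ L, Legal v F ω L ∧ m ≤ L.length + 1 ∧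
      ((L.map k).sum : ℝ) ≤ θ * L.length} ≤
      ENNReal.ofReal ((Real.exp 1 * Δ) ^ (δ * (1 - m)) * 2 ^ Fintype.card C) := by
  classical
  have hΔ₁ : (1 : ℝ) ≤ Δ := by exact_mod_cast hΔ₀
  have hρ : 1 ≤ Real.exp 1 * Δ := by
    have := Real.add_one_le_exp 1
    nlinarith
  have hb : (1 : ℝ) ≤ b := by exact_mod_cast Nat.one_le_iff_ne_zero.2 (NeZero.ne b)
  let E : List C → Prop := fun L => m ≤ L.length + 1 ∧ ((L.map k).sum : ℝ) ≤ θ * L.length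
  let Ω : ℕ → Set (P × ℕ → Fin b) := fun n => {ω | ∃ S, (IsLayered r Finset.univ S ∧
    S.length ≤ n) ∧ E (word S) ∧ Legal v F ω (word S)}
  have hsub : {ω | ∃ L, Legal v F ω L ∧ m ≤ L.length + 1 ∧
      ((L.map k).sum : ℝ) ≤ θ * L.length} ⊆ ⋃ n, Ω n := by
    rintro ω ⟨L, hL, hE⟩
    obtain ⟨S, hS, h⟩ := exists_isLayered (r := r) L
    refine Set.mem_iUnion.2 ⟨S.length, S, ⟨hS, le_rfl⟩, ?_, hL.of_traceEquiv hr hF h⟩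
    change _ ∧ _
    rw [← h.perm.length_eq, ← (h.perm.map k).sum_eq]
    exact hE
  have hmono : Monotone Ω := fun n n' hn ω ⟨S, ⟨hS, hSn⟩, h⟩ => ⟨S, ⟨hS, hSn.trans hn⟩, h⟩
  refine (measure_mono hsub).trans ?_
  -- Continuity from below reduces to at most `n` layers, hence to a finite union bound uniform in
  -- `n`.
  rw [hmono.measure_iUnion]
  refine iSup_le fun n => ?_
  let W := (layerings r n Finset.univ).filter fun S => E (word S)
  have hΩ : Ω n ⊆ ⋃ S ∈ W, {ω | Legal v F ω (word S)} := by
    rintro ω ⟨S, ⟨hS, hSn⟩, hE, h⟩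
    exact Set.mem_biUnion (Finset.mem_filter.2 ⟨hS.mem_layerings hSn, hE⟩) h
  have ht : (1 + 1 / (Δ : ℝ)) ^ Δ ≤ Real.exp 1 := by
    calc (1 + 1 / (Δ : ℝ)) ^ Δ ≤ Real.exp (1 / (Δ : ℝ)) ^ Δ := by
          gcongr
          rw [add_comm]
          exact Real.add_one_le_exp _
      _ = Real.exp 1 := by
          rw [← Real.exp_nat_mul]
          congr 1
          field_simp
  -- With `t = 1/Δ`, the bound `(1 + 1/Δ) ^ Δ ≤ e` makes `z = 1/(eΔ)` admissible; this is the origin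
  -- of `eΔ`.
  have hsum := sum_layerings_le hΔ (z := 1 / (Real.exp 1 * Δ)) (t := 1 / Δ) (by positivity)
    (by positivity) (by
      calc 1 / (Real.exp 1 * Δ) * (1 + 1 / (Δ : ℝ)) ^ Δ
          ≤ 1 / (Real.exp 1 * Δ) * Real.exp 1 := by gcongr
        _ = 1 / Δ := by field_simp) n Finset.univ
  have hreal : (tableMeasure P b).real (⋃ S ∈ W, {ω | Legal v F ω (word S)}) ≤
      (Real.exp 1 * Δ) ^ (δ * (1 - m)) * 2 ^ Fintype.card C := by
    calc _ ≤ ∑ S ∈ W, (tableMeasure P b).real {ω | Legal v F ω (word S)} :=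
          measureReal_biUnion_finset_le _ _
      _ ≤ ∑ S ∈ W, (Real.exp 1 * Δ) ^ (δ * (1 - m)) *
            (1 / (Real.exp 1 * Δ)) ^ (word S).length := by
          refine Finset.sum_le_sum fun S hS => (tableMeasure_legal_le hF _).trans ?_
          obtain ⟨h1, h2⟩ := (Finset.mem_filter.1 hS).2
          exact prod_weight_le hρ hb hδ (fun c => by positivity) hq h1 h2
      _ ≤ ∑ S ∈ layerings r n Finset.univ, (Real.exp 1 * Δ) ^ (δ * (1 - m)) *
            (1 / (Real.exp 1 * Δ)) ^ (word S).length :=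
          Finset.sum_le_sum_of_subset_of_nonneg (Finset.filter_subset _ _)
            fun S _ _ => by positivity
      _ ≤ (Real.exp 1 * Δ) ^ (δ * (1 - m)) * 2 ^ Fintype.card C := by
          rw [← Finset.mul_sum]
          gcongr
          refine hsum.trans ?_
          rw [Finset.card_univ]
          gcongr
          have : 1 / (Δ : ℝ) ≤ 1 := by
            rw [div_le_one (by positivity)]
            exact hΔ₁
          linarith
  refine (measure_mono hΩ).trans ?_
  rw [← ofReal_measureReal (measure_ne_top _ _)]
  exact ENNReal.ofReal_le_ofReal hreal

end Logs

/-! ### Balls and degrees -/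

section Digraphs

variable {V : Type u} {G : Digraph V}

theorem mem_ball_self (x : V) (r : ℕ) : x ∈ ball G x r := by simp [ball]

theorem ball_mono (x : V) {r s : ℕ} (h : r ≤ s) : ball G x r ⊆ ball G x s :=
  fun _ hy => le_trans (Set.mem_ofPred.1 hy) (Nat.cast_le.2 h)

theorem mem_ball_succ {x y z : V} {r : ℕ} (hy : y ∈ ball G x r) (h : G.Adj y z ∨ G.Adj z y) :
    z ∈ ball G x (r + 1) := by
  have h1 : G.toSimpleGraphInclusive.edist y z ≤ 1 := by
    rw [SimpleGraph.edist_le_one_iff_adj_or_eq]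
    by_cases hyz : y = z
    · exact Or.inr hyz
    · exact Or.inl ⟨hyz, h⟩
  calc G.toSimpleGraphInclusive.edist x z
      ≤ G.toSimpleGraphInclusive.edist x y + G.toSimpleGraphInclusive.edist y z :=
        SimpleGraph.edist_triangle
    _ ≤ (r : ℕ∞) + 1 := add_le_add hy h1
    _ = ((r + 1 : ℕ) : ℕ∞) := by push_cast; rfl

theorem encard_nbhd_le {d : ℕ} (h : maxDeg G ≤ d) (x : V) : (nbhd G x).encard ≤ d :=
  (le_iSup (fun x => (nbhd G x).encard) x).trans h

theorem finite_var {d : ℕ} (h : maxDeg G ≤ d) (x : V) : (Var G x).Finite :=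
  (Set.finite_of_encard_le_coe (encard_nbhd_le h x)).subset Set.subset_union_left

theorem ncard_var_le {d : ℕ} (h : maxDeg G ≤ d) (x : V) : (Var G x).ncard ≤ d := by
  have := (Set.encard_le_encard Set.subset_union_left).trans (encard_nbhd_le h x)
  rwa [← (finite_var h x).cast_ncard_eq, Nat.cast_le] at this

end Digraphs

theorem card_filter_forall_mem_eq {P : Type*} [Fintype P] [DecidableEq P] {b : ℕ}
    (s : Finset P) (g₀ : P → Fin b) :
    (Finset.univ.filter fun g : P → Fin b => ∀ y ∈ s, g y = g₀ y).card =
      b ^ (Fintype.card P - s.card) := by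
  have : (Finset.univ.filter fun g : P → Fin b => ∀ y ∈ s, g y = g₀ y) =
      Fintype.piFinset fun y => if y ∈ s then {g₀ y} else Finset.univ := by
    ext g
    simp only [Finset.mem_filter, Finset.mem_univ, true_and, Fintype.mem_piFinset]
    refine forall_congr' fun y => ?_
    split_ifs with h <;> simp [h]
  rw [this, Fintype.card_piFinset]
  have h2 : ∀ y, (if y ∈ s then {g₀ y} else (Finset.univ : Finset (Fin b))).card =
      if y ∈ s then 1 else b := fun y => by split_ifs <;> simp
  rw [Finset.prod_congr rfl fun y _ => h2 y, Finset.prod_ite]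
  simp only [Finset.prod_const_one, one_mul, Finset.prod_const]
  congr 1
  rw [← Finset.compl_filter, Finset.card_compl]
  simp

/-! ### Windows: clauses restricted to a finite set of variables and relabelled by parts -/

namespace Tuple

variable {V : Type u} {b : ℕ} (M : Tuple V b)

section Window

variable (U A : Set V)

open Classical in
/-- The variables in `A` of the clauses in `U`, both labelled by their parts. -/
noncomputable def windowVar (c : M.partition.parts) : Finset M.partition.parts :=
  Finset.univ.filter fun y => ∃ u ∈ U, M.partition.part u = c ∧
    ∃ w ∈ Var M.graph u ∩ A, M.partition.part w = y

open Classical in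
/-- The colourings of the parts that, read on `A`, extend to a violation of a clause in `U` with
the given label. -/
noncomputable def windowBad (c : M.partition.parts) :
    Finset (M.partition.parts → Fin b) :=
  Finset.univ.filter fun g => ∃ u ∈ U, M.partition.part u = c ∧
    ∃ f ∈ (M.rule.allowed u)ᶜ, ∀ w : Var M.graph u, (w : V) ∈ A → f w = g (M.partition.part w)

/-- The number of variables outside `A` of the clauses in `U` with the given label. -/
noncomputable def windowBoundary (c : M.partition.parts) : ℕ :=
  {w | w ∉ A ∧ ∃ u ∈ U, M.partition.part u = c ∧ w ∈ Var M.graph u}.ncard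

/-- A finite set `U` on which the parts separate points, together with a set `A` such that `U`
contains `A` and all the clauses that have a variable in `A`. -/
structure IsWindow : Prop where
  finite : U.Finite
  injOn : Set.InjOn M.partition.part U
  subset : A ⊆ U
  clause_mem : ∀ u, (Var M.graph u ∩ A).Nonempty → u ∈ U

variable {M U A}

theorem mem_windowVar {c y : M.partition.parts} : y ∈ M.windowVar U A c ↔
    ∃ u ∈ U, M.partition.part u = c ∧ ∃ w ∈ Var M.graph u ∩ A, M.partition.part w = y := by
  simp [windowVar]

theorem mem_windowBad {c : M.partition.parts} {g : M.partition.parts → Fin b} :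
    g ∈ M.windowBad U A c ↔ ∃ u ∈ U, M.partition.part u = c ∧
      ∃ f ∈ (M.rule.allowed u)ᶜ,
        ∀ w : Var M.graph u, (w : V) ∈ A → f w = g (M.partition.part w) := by
  simp [windowBad]

theorem windowBad_congr (c : M.partition.parts) (g g' : M.partition.parts → Fin b)
    (h : ∀ y ∈ M.windowVar U A c, g y = g' y) (hg : g ∈ M.windowBad U A c) :
    g' ∈ M.windowBad U A c := by
  obtain ⟨u, hu, rfl, f, hf, hfg⟩ := mem_windowBad.1 hg
  refine mem_windowBad.2 ⟨u, hu, rfl, f, hf, fun w hw => ?_⟩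
  rw [hfg w hw, h _ (mem_windowVar.2 ⟨u, hu, rfl, w, ⟨w.2, hw⟩, rfl⟩)]

namespace IsWindow

variable (hW : M.IsWindow U A)
include hW

theorem part_mem_windowVar {u w : V} (hu : u ∈ U) (hw : w ∈ A) :
    M.partition.part w ∈ M.windowVar U A (M.partition.part u) ↔ w ∈ Var M.graph u := by
  rw [mem_windowVar]
  constructor
  · rintro ⟨u', hu', h, w', ⟨hw', hA⟩, h'⟩
    obtain rfl := hW.injOn hu' hu h
    rwa [← hW.injOn (hW.subset hA) (hW.subset hw) h']
  · exact fun h => ⟨u, hu, rfl, w, ⟨h, hw⟩, rfl⟩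

theorem card_windowVar (u : V) (hu : u ∈ U) :
    (M.windowVar U A (M.partition.part u)).card = (Var M.graph u ∩ A).ncard := by
  have : (M.windowVar U A (M.partition.part u) : Set M.partition.parts) =
      M.partition.part '' (Var M.graph u ∩ A) := by
    ext y
    rw [Finset.mem_coe, mem_windowVar]
    constructor
    · rintro ⟨u', hu', h, w, hw, rfl⟩
      obtain rfl := hW.injOn hu' hu h
      exact ⟨w, hw, rfl⟩
    · rintro ⟨w, hw, rfl⟩
      exact ⟨u, hu, rfl, w, hw, rfl⟩
  rw [← Set.ncard_coe_finset, this]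
  exact (hW.injOn.mono fun w hw => hW.subset hw.2).ncard_image

theorem windowBoundary_part (u : V) (hu : u ∈ U) :
    M.windowBoundary U A (M.partition.part u) = (Var M.graph u \ A).ncard := by
  unfold windowBoundary
  congr 1
  ext w
  constructor
  · rintro ⟨hw, u', hu', h, hw'⟩
    obtain rfl := hW.injOn hu' hu h
    exact ⟨hw', hw⟩
  · rintro ⟨hw', hw⟩
    exact ⟨hw, u, hu, rfl, hw'⟩

theorem card_windowVar_le {d : ℕ} (hd : maxDeg M.graph ≤ d) (c : M.partition.parts) :
    (M.windowVar U A c).card ≤ d := by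
  by_cases hc : ∃ u ∈ U, M.partition.part u = c
  · obtain ⟨u, hu, rfl⟩ := hc
    rw [hW.card_windowVar u hu]
    exact (Set.ncard_le_ncard Set.inter_subset_left (finite_var hd u)).trans (ncard_var_le hd u)
  · have : M.windowVar U A c = ∅ := by
      refine Finset.eq_empty_of_forall_notMem fun y hy => hc ?_
      obtain ⟨u, hu, h, _⟩ := mem_windowVar.1 hy
      exact ⟨u, hu, h⟩
    simp [this]

theorem windowBoundary_le {d : ℕ} (hd : maxDeg M.graph ≤ d) (c : M.partition.parts) :
    M.windowBoundary U A c ≤ d := by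
  by_cases hc : ∃ u ∈ U, M.partition.part u = c
  · obtain ⟨u, hu, rfl⟩ := hc
    rw [hW.windowBoundary_part u hu]
    exact (Set.ncard_le_ncard Set.sdiff_subset (finite_var hd u)).trans (ncard_var_le hd u)
  · have : {w | w ∉ A ∧ ∃ u ∈ U, M.partition.part u = c ∧ w ∈ Var M.graph u} = ∅ := by
      refine Set.eq_empty_of_forall_notMem fun w hw => hc ?_
      obtain ⟨_, u, hu, h, _⟩ := hw
      exact ⟨u, hu, h⟩
    simp [windowBoundary, this]

theorem card_windowBad_le {d : ℕ} (hd : maxDeg M.graph ≤ d) {u : V} (hu : u ∈ U) :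
    (M.windowBad U A (M.partition.part u)).card ≤
      (M.rule.allowed u)ᶜ.ncard *
        b ^ (Fintype.card M.partition.parts - (Var M.graph u ∩ A).ncard) := by
  classical
  have : Finite (Var M.graph u) := finite_var hd u
  let _ := Fintype.ofFinite (Var M.graph u)
  let Z : (Var M.graph u → Fin b) → Finset (M.partition.parts → Fin b) := fun f =>
    Finset.univ.filter fun g => ∀ w : Var M.graph u, (w : V) ∈ A → f w = g (M.partition.part w)
  have hsub : M.windowBad U A (M.partition.part u) ⊆
      (Set.toFinite (M.rule.allowed u)ᶜ).toFinset.biUnion Z := by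
    intro g hg
    obtain ⟨u', hu', h, f, hf, hfg⟩ := mem_windowBad.1 hg
    obtain rfl := hW.injOn hu' hu h
    exact Finset.mem_biUnion.2 ⟨f, by simpa using hf, by simpa [Z] using hfg⟩
  refine (Finset.card_le_card hsub).trans ?_
  rw [Set.ncard_eq_toFinset_card (M.rule.allowed u)ᶜ]
  refine Finset.card_biUnion_le_card_mul _ _ _ fun f _ => ?_
  rcases (Z f).eq_empty_or_nonempty with h | ⟨g₀, hg₀⟩
  · simp [h]
  · rw [← hW.card_windowVar u hu, ← card_filter_forall_mem_eq _ g₀]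
    refine Finset.card_le_card fun g hg => ?_
    simp only [Z, Finset.mem_filter, Finset.mem_univ, true_and] at hg hg₀ ⊢
    intro y hy
    obtain ⟨u', hu', h, w, hw, rfl⟩ := mem_windowVar.1 hy
    obtain rfl := hW.injOn hu' hu h
    rw [← hg ⟨w, hw.1⟩ hw.2, ← hg₀ ⟨w, hw.1⟩ hw.2]

/-- Each violating colouring fixes the colours of only `|Var u ∩ A|` parts. Compared with the
violation probability of `u`, one factor `b` is lost for each variable of `u` outside `A`. -/
theorem card_windowBad_div_le [NeZero b] {d : ℕ} (hd : maxDeg M.graph ≤ d) {q : ℝ} (hq₀ : 0 ≤ q)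
    (hq : ∀ u, M.rule.violationProb u ≤ q) (c : M.partition.parts) :
    ((M.windowBad U A c).card : ℝ) / (b : ℝ) ^ Fintype.card M.partition.parts ≤
      q * (b : ℝ) ^ M.windowBoundary U A c := by
  have hb : (0 : ℝ) < b := by exact_mod_cast Nat.pos_of_ne_zero (NeZero.ne b)
  by_cases hc : ∃ u ∈ U, M.partition.part u = c
  · obtain ⟨u, hu, rfl⟩ := hc
    have h1 : (M.windowVar U A (M.partition.part u)).card ≤ Fintype.card M.partition.parts :=
      Finset.card_le_univ _
    rw [hW.card_windowVar u hu] at h1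
    have h2 := Set.ncard_inter_add_ncard_sdiff_eq_ncard (Var M.graph u) A (finite_var hd u)
    have h3 : ((M.windowBad U A (M.partition.part u)).card : ℝ) ≤ _ :=
      Nat.cast_le.2 (hW.card_windowBad_le hd hu)
    rw [hW.windowBoundary_part u hu, div_le_iff₀ (by positivity)]
    refine h3.trans ?_
    have h4 := hq u
    rw [LocalRule.violationProb, div_le_iff₀ (by positivity), ← h2] at h4
    obtain ⟨t, ht⟩ := Nat.exists_eq_add_of_le h1
    rw [ht, Nat.add_sub_cancel_left]
    push_cast
    calc ((M.rule.allowed u)ᶜ.ncard : ℝ) * (b : ℝ) ^ t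
        ≤ (q * (b : ℝ) ^ ((Var M.graph u ∩ A).ncard + (Var M.graph u \ A).ncard)) * (b : ℝ) ^ t := by
          gcongr
      _ = _ := by ring
  · have : M.windowBad U A c = ∅ := by
      refine Finset.eq_empty_of_forall_notMem fun y hy => hc ?_
      obtain ⟨u, hu, h, _⟩ := mem_windowBad.1 hy
      exact ⟨u, hu, h⟩
    rw [this]
    simp only [Finset.card_empty, Nat.cast_zero, zero_div]
    positivity

/-- A label without variables in the window is related only to itself, which is where `0 < Δ`
enters. Otherwise it comes from some `u ∈ U`, and all related labels come from `Rel`-neighbours of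
`u`, among them `u` itself because of its self-loop. -/
theorem card_reach_le {Δ : ℕ} (hΔ₀ : 0 < Δ) (hΔ : maxDeg (Rel M.graph) ≤ Δ)
    (a : M.partition.parts) :
    (reach (fun c c' => c = c' ∨ ¬ Disjoint (M.windowVar U A c) (M.windowVar U A c'))
      {a}).card ≤ Δ := by
  rcases (M.windowVar U A a).eq_empty_or_nonempty with h | ⟨y, hy⟩
  · refine (Finset.card_le_one.2 ?_).trans hΔ₀
    simp [h]
  · obtain ⟨u, hu, rfl, w, hw, rfl⟩ := mem_windowVar.1 hy
    rw [← Nat.cast_le (α := ℕ∞), ← Set.encard_coe_eq_coe_finsetCard]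
    refine le_trans ?_ (encard_nbhd_le hΔ u)
    refine le_trans (Set.encard_le_encard ?_) (Set.encard_image_le M.partition.part _)
    intro c hc
    rw [Finset.mem_coe, mem_reach] at hc
    obtain ⟨a, ha, hc⟩ := hc
    rw [Finset.mem_singleton] at ha
    subst ha
    rcases hc with rfl | hc
    · exact ⟨u, Or.inl ⟨w, hw.1, hw.1⟩, rfl⟩
    · obtain ⟨y, hy, hy'⟩ := Finset.not_disjoint_iff.1 hc
      obtain ⟨u', hu', rfl, w', hw', rfl⟩ := mem_windowVar.1 hy'
      rw [hW.part_mem_windowVar hu hw'.2] at hy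
      exact ⟨u', Or.inl ⟨w', hy, hw'.1⟩, rfl⟩

end IsWindow

end Window

end Tuple

/-! ### From runs of the algorithm to legal logs -/

namespace Tuple

variable {V : Type u} {b : ℕ} (M : Tuple V b)
  (I : ℕ → IndependenceFunction (Rel M.graph)) (rnd : M.Source)

theorem count_succ_pos (j : ℕ) (x : V) : 1 ≤ M.count I rnd (j + 1) x :=
  M.count_mono I rnd x (Nat.le_add_left 1 j)

theorem count_succ_le (j : ℕ) (x : V) : M.count I rnd (j + 1) x ≤ M.count I rnd j x + 1 := by
  cases j with
  | zero => simp [count_one]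
  | succ j =>
    rw [count_succ_succ]
    split_ifs <;> omega

theorem col_eq (j : ℕ) (x : V) :
    M.col I rnd j x = rnd (M.partition.part x, M.count I rnd (j + 1) x - 1) := by
  induction j with
  | zero => rfl
  | succ j ih =>
    rw [col_succ, count_succ_succ]
    split_ifs
    · simp
    · exact ih

theorem exists_le_totalCount {m : ℕ} (hm : m ≠ 0)
    (h : (m : ℕ∞) ≤ ⨆ x, M.totalCount I rnd x) : ∃ j x, m ≤ M.count I rnd j x := by
  by_contra! hlt
  have : ⨆ x, M.totalCount I rnd x ≤ ((m - 1 : ℕ) : ℕ∞) :=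
    iSup_le fun x => iSup_le fun j => Nat.cast_le.2 (Nat.le_sub_one_of_lt (hlt j x))
  have := Nat.cast_le.1 (h.trans this)
  omega

variable {M I rnd}

open Classical in
/-- One round of the algorithm, seen through a window: the clauses resampled simultaneously may be
appended to the log one after the other. -/
theorem IsWindow.exists_legal_round {U A : Set V} (hW : M.IsWindow U A) {D : Finset V}
    (hD : ∀ u, (Var M.graph u ∩ A).Nonempty → Var M.graph u \ A ⊆ D) {j : ℕ}
    {L : List M.partition.parts} (hL : Legal (M.windowVar U A) (M.windowBad U A) rnd L)
    (hh : ∀ y ∈ A, height (M.windowVar U A) L (M.partition.part y) + 1 = M.count I rnd (j + 1) y)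
    (hk : (L.map (M.windowBoundary U A)).sum + D.card ≤ ∑ w ∈ D, M.count I rnd (j + 1) w)
    (s : Finset V) (hs : ∀ u ∈ s, u ∈ (I j).toFun (M.rule.bad (M.col I rnd j)) ∧
      (Var M.graph u ∩ A).Nonempty) :
    ∃ L : List M.partition.parts, Legal (M.windowVar U A) (M.windowBad U A) rnd L ∧
      (∀ y ∈ A, height (M.windowVar U A) L (M.partition.part y) + 1 =
        M.count I rnd (j + 1) y + (s.filter fun u => y ∈ Var M.graph u).card) ∧
      (L.map (M.windowBoundary U A)).sum + D.card ≤
        ∑ w ∈ D, (M.count I rnd (j + 1) w + (s.filter fun u => w ∈ Var M.graph u).card) := by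
  induction s using Finset.induction_on with
  | empty => exact ⟨L, hL, by simpa using hh, by simpa using hk⟩
  | insert u s hu ih =>
    obtain ⟨L, hL, hh, hk⟩ := ih fun u' hu' => hs u' (Finset.mem_insert_of_mem hu')
    obtain ⟨huI, huA⟩ := hs u (Finset.mem_insert_self u s)
    have huU := hW.clause_mem u huA
    have hmax := ((I j).maximal (M.rule.bad (M.col I rnd j))).1
    have hcard : ∀ y, ((insert u s).filter fun u => y ∈ Var M.graph u).card =
        (s.filter fun u => y ∈ Var M.graph u).card + if y ∈ Var M.graph u then 1 else 0 := by
      intro y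
      rw [Finset.filter_insert]
      split_ifs
      · rw [Finset.card_insert_of_notMem (by simp [hu])]
      · simp
    refine ⟨M.partition.part u :: L, ⟨hL, ?_⟩, fun y hy => ?_, ?_⟩
    · refine mem_windowBad.2 ⟨u, huU, rfl, _, hmax.1 huI, fun w hw => ?_⟩
      -- Clauses resampled in the same round have disjoint variables, so those already appended have
      -- not moved the variables of `u`: the log still reads their colours at time `j`.
      have h0 : (s.filter fun u => (w : V) ∈ Var M.graph u) = ∅ := by
        refine Finset.filter_eq_empty_iff.2 fun u' hu' hw' => ?_
        refine hmax.2 u huI u' (hs u' (Finset.mem_insert_of_mem hu')).1 ?_ ⟨w, w.2, hw'⟩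
        rintro rfl
        exact hu hu'
      have := hh w hw
      rw [h0, Finset.card_empty, add_zero] at this
      rw [col_eq, ← this, Nat.add_sub_cancel]
    · rw [height_cons, hcard, ← add_assoc, ← hh y hy, add_right_comm]
      simp only [hW.part_mem_windowVar huU hy]
    · simp only [hcard, List.map_cons, List.sum_cons, ← add_assoc]
      rw [Finset.sum_add_distrib, hW.windowBoundary_part u huU]
      have h1 : (Var M.graph u \ A).ncard ≤ ∑ w ∈ D, if w ∈ Var M.graph u then 1 else 0 := by
        rw [← Finset.card_filter, ← Set.ncard_coe_finset]
        refine Set.ncard_le_ncard (fun w hw => ?_) (Finset.finite_toSet _)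
        simpa using ⟨hD u huA hw, hw.1⟩
      omega

-- The height is one less than the count because the initial sampling is not in the log. On the
-- shell `D` there is only an inequality, since its vertices may also be resampled by clauses
-- without a variable in `A`; the term `D.card` accounts for the initial samplings there.
open Classical in
theorem IsWindow.exists_legal {U A : Set V} (hW : M.IsWindow U A) {D : Finset V}
    (hD : ∀ u, (Var M.graph u ∩ A).Nonempty → Var M.graph u \ A ⊆ D) (j : ℕ) :
    ∃ L : List M.partition.parts, Legal (M.windowVar U A) (M.windowBad U A) rnd L ∧
      (∀ y ∈ A, height (M.windowVar U A) L (M.partition.part y) + 1 = M.count I rnd (j + 1) y) ∧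
      (L.map (M.windowBoundary U A)).sum + D.card ≤ ∑ w ∈ D, M.count I rnd (j + 1) w := by
  induction j with
  | zero => exact ⟨[], trivial, by simp [count_one], by simp [count_one]⟩
  | succ j ih =>
    obtain ⟨L, hL, hh, hk⟩ := ih
    let J : Set V := {u | u ∈ (I j).toFun (M.rule.bad (M.col I rnd j)) ∧
      (Var M.graph u ∩ A).Nonempty}
    have hJ : J.Finite := hW.finite.subset fun u hu => hW.clause_mem u hu.2
    obtain ⟨L', hL', hh', hk'⟩ := hW.exists_legal_round hD hL hh hk hJ.toFinset (by simp [J])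
    have hle : ∀ w, M.count I rnd (j + 1) w + (hJ.toFinset.filter fun u => w ∈ Var M.graph u).card ≤
        M.count I rnd (j + 2) w := by
      intro w
      rw [count_succ_succ]
      have h1 : (hJ.toFinset.filter fun u => w ∈ Var M.graph u).card ≤ 1 := by
        refine Finset.card_le_one.2 fun u hu u' hu' => ?_
        simp only [Finset.mem_filter, Set.Finite.mem_toFinset] at hu hu'
        by_contra hne
        exact ((I j).maximal (M.rule.bad (M.col I rnd j))).1.2 u hu.1.1 u' hu'.1.1 hne
          ⟨w, hu.2, hu'.2⟩
      split_ifs with hw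
      · omega
      · have : (hJ.toFinset.filter fun u => w ∈ Var M.graph u) = ∅ := by
          refine Finset.filter_eq_empty_iff.2 fun u hu huw => hw ?_
          exact Set.mem_biUnion (hJ.mem_toFinset.1 hu).1 huw
        simp [this]
    refine ⟨L', hL', fun y hy => ?_, hk'.trans (Finset.sum_le_sum fun w _ => hle w)⟩
    rw [hh' y hy]
    refine le_antisymm (hle y) ?_
    rw [count_succ_succ]
    split_ifs with hw
    · obtain ⟨u, hu, huy⟩ := Set.mem_iUnion₂.1 hw
      refine Nat.add_le_add_left (Finset.card_pos.2 ⟨u, ?_⟩) _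
      simpa using ⟨⟨hu, ⟨y, huy, hy⟩⟩, huy⟩
    · exact Nat.le_add_right _ _

variable (M) in
theorem isWindow_ball {R i d : ℕ} {ε : ℝ} (hG : IsSubexp M.graph R ε d)
    (hπ : M.partition.IsSparse M.graph (3 * R)) (hi : i < R) (x : V) :
    M.IsWindow (ball M.graph x (3 * R)) (ball M.graph x (3 * i)) where
  finite := (hG.2 x).1
  injOn := hπ x
  subset := ball_mono x (by omega)
  clause_mem := fun u ⟨w, huw, hw⟩ =>
    ball_mono x (by omega : 3 * i + 1 ≤ 3 * R) (mem_ball_succ hw (Or.inr huw))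

/-- Growth by more than `1 + ε` at every step would compound to more than `(1 + ε) ^ R`. -/
theorem exists_lt_growth {R : ℕ} (hR : 0 < R) {ε : ℝ} (hε : 0 < ε) {S : ℕ → ℝ}
    (h : S R ≤ S 0 * (1 + ε) ^ R) : ∃ i < R, S (i + 1) ≤ (1 + ε) * S i := by
  by_contra! hlt
  have key : ∀ i ≤ R, 0 < i → S 0 * (1 + ε) ^ i < S i := by
    intro i
    induction i with
    | zero => simp
    | succ i ih =>
      intro hi _
      have h1 := hlt i hi
      rcases Nat.eq_zero_or_pos i with rfl | hi₀
      · simpa [mul_comm] using h1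
      · have h2 := ih (by omega) hi₀
        rw [pow_succ]
        nlinarith
  exact absurd h (not_le.2 (key R le_rfl hR))

theorem exists_legal_of_le_totalCount {R d m : ℕ} {ε : ℝ} (hR : 0 < R) (hε : 0 < ε)
    (hG : IsSubexp M.graph R ε d) (hπ : M.partition.IsSparse M.graph (3 * R)) (hm : 2 ≤ m)
    (h : (m : ℕ∞) ≤ ⨆ x, M.totalCount I rnd x) :
    ∃ x, ∃ i < R, ∃ L : List M.partition.parts,
      Legal (M.windowVar (ball M.graph x (3 * R)) (ball M.graph x (3 * i)))
        (M.windowBad (ball M.graph x (3 * R)) (ball M.graph x (3 * i))) rnd L ∧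
      m ≤ L.length + 1 ∧
      ((L.map (M.windowBoundary (ball M.graph x (3 * R)) (ball M.graph x (3 * i)))).sum : ℝ) ≤
        ε * d * L.length := by
  classical
  have hex := M.exists_le_totalCount I rnd (by omega) h
  obtain ⟨T, hT⟩ : ∃ T, Nat.find hex = T + 1 := by
    refine Nat.exists_eq_succ_of_ne_zero fun h0 => ?_
    obtain ⟨x, hx⟩ := Nat.find_spec hex
    rw [h0, count_zero] at hx
    omega
  obtain ⟨x, hx⟩ := Nat.find_spec hex
  rw [hT] at hx
  -- Minimality of `T + 1` bounds all counts by `m - 1` one step earlier, and a step adds at most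
  -- one.
  have hle : ∀ y, M.count I rnd (T + 1) y ≤ m := by
    intro y
    have h1 := Nat.find_min hex (m := T) (by omega)
    push Not at h1
    have := M.count_succ_le I rnd T y
    have := h1 y
    omega
  have hfin : ∀ i ≤ R, (ball M.graph x (3 * i)).Finite := fun i hi =>
    (hG.2 x).1.subset (ball_mono x (by omega))
  let B : ℕ → Finset V := fun i =>
    if hi : i ≤ R then (hfin i hi).toFinset else ∅
  have hB : ∀ i ≤ R, ∀ y, y ∈ B i ↔ y ∈ ball M.graph x (3 * i) := by
    intro i hi y
    simp [B, hi]
  -- Subtracting the initial sampling turns counts into heights of the log. It also makes `S 0 ≥ m -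
  -- 1` match the maximal summand `m - 1` in `S R`.
  let S : ℕ → ℕ := fun i => ∑ y ∈ B i, (M.count I rnd (T + 1) y - 1)
  have hS0 : m - 1 ≤ S 0 := by
    refine le_trans (Nat.sub_le_sub_right hx 1) ?_
    exact Finset.single_le_sum (f := fun y => M.count I rnd (T + 1) y - 1) (fun _ _ => Nat.zero_le _)
      ((hB 0 (Nat.zero_le R) x).2 (mem_ball_self x _))
  have hSR : (S R : ℝ) ≤ S 0 * (1 + ε) ^ R := by
    have h1 : S R ≤ (B R).card * (m - 1) := by
      rw [← smul_eq_mul]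
      exact Finset.sum_le_card_nsmul _ _ _ fun y _ => Nat.sub_le_sub_right (hle y) 1
    have h2 : (B R).card = (ball M.graph x (3 * R)).ncard := by
      rw [← Set.ncard_coe_finset]
      congr 1
      ext y
      exact hB R le_rfl y
    have h3 : ((B R).card : ℝ) ≤ (1 + ε) ^ R := by
      rw [h2]
      exact (hG.2 x).2
    calc (S R : ℝ) ≤ ((B R).card : ℝ) * ((m - 1 : ℕ) : ℝ) := by exact_mod_cast h1
      _ ≤ (1 + ε) ^ R * S 0 := by gcongr
      _ = _ := mul_comm _ _
  obtain ⟨i, hi, hSi⟩ := exists_lt_growth hR hε (S := fun i => (S i : ℝ)) hSR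
  have hW := M.isWindow_ball hG hπ hi x
  have hBsub : B i ⊆ B (i + 1) := fun y hy =>
    (hB (i + 1) hi y).2 (ball_mono x (by omega) ((hB i hi.le y).1 hy))
  have hD : ∀ u, (Var M.graph u ∩ ball M.graph x (3 * i)).Nonempty →
      Var M.graph u \ ball M.graph x (3 * i) ⊆ ((B (i + 1) \ B i : Finset V) : Set V) := by
    rintro u ⟨w, huw, hw⟩ y ⟨hy, hyi⟩
    rw [Finset.mem_coe, Finset.mem_sdiff, hB _ hi, hB _ hi.le]
    -- From a variable in `A` to a clause and on to another of its variables takes two edges, so a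
    -- shell of width three suffices.
    refine ⟨ball_mono x (by omega : 3 * i + 1 + 1 ≤ 3 * (i + 1)) ?_, hyi⟩
    exact mem_ball_succ (mem_ball_succ hw (Or.inr huw)) (Or.inl hy)
  obtain ⟨L, hL, hh, hk⟩ := hW.exists_legal (I := I) (rnd := rnd) hD T
  refine ⟨x, i, hi, L, hL, ?_, ?_⟩
  · have h1 := hh x (mem_ball_self x _)
    have h2 := height_le_length (M.windowVar (ball M.graph x (3 * R)) (ball M.graph x (3 * i))) L
      (M.partition.part x)
    omega
  -- Each log entry raises at most `d` heights, so `S i ≤ d |L|`; boundary occurrences number at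
  -- most `S (i+1) - S i ≤ ε S i`.
  · have hsum : S i ≤ d * L.length := by
      calc S i = ∑ y ∈ B i, height (M.windowVar (ball M.graph x (3 * R))
              (ball M.graph x (3 * i))) L (M.partition.part y) :=
            Finset.sum_congr rfl fun y hy => by
              have := hh y ((hB i hi.le y).1 hy)
              omega
        _ = ∑ c ∈ (B i).image M.partition.part, height (M.windowVar (ball M.graph x (3 * R))
              (ball M.graph x (3 * i))) L c := by
            rw [Finset.sum_image]
            intro y hy y' hy' h
            exact hπ x (hW.subset ((hB i hi.le y).1 hy)) (hW.subset ((hB i hi.le y').1 hy')) h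
        _ ≤ ∑ c, height (M.windowVar (ball M.graph x (3 * R))
              (ball M.graph x (3 * i))) L c :=
            Finset.sum_le_sum_of_subset (Finset.subset_univ _)
        _ ≤ d * L.length := by
            rw [sum_height]
            refine (List.sum_le_card_nsmul _ d fun n hn => ?_).trans_eq ?_
            · obtain ⟨c, _, rfl⟩ := List.mem_map.1 hn
              exact hW.card_windowVar_le hG.1 c
            · simp [mul_comm]
    have hbd : (L.map (M.windowBoundary (ball M.graph x (3 * R))
        (ball M.graph x (3 * i)))).sum + S i ≤ S (i + 1) := by
      have h1 : S (i + 1) = (∑ w ∈ B (i + 1) \ B i, (M.count I rnd (T + 1) w - 1)) + S i :=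
        (Finset.sum_sdiff hBsub).symm
      have h2 : (∑ w ∈ B (i + 1) \ B i, (M.count I rnd (T + 1) w - 1)) + (B (i + 1) \ B i).card =
          ∑ w ∈ B (i + 1) \ B i, M.count I rnd (T + 1) w := by
        rw [Finset.card_eq_sum_ones, ← Finset.sum_add_distrib]
        exact Finset.sum_congr rfl fun w _ => Nat.sub_add_cancel (M.count_succ_pos I rnd T w)
      omega
    have h1 : ((L.map (M.windowBoundary (ball M.graph x (3 * R))
        (ball M.graph x (3 * i)))).sum : ℝ) + S i ≤ S (i + 1) := by exact_mod_cast hbd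
    have h2 : (S i : ℝ) ≤ d * L.length := by exact_mod_cast hsum
    calc _ ≤ ε * (S i : ℝ) := by linarith
      _ ≤ ε * (d * L.length) := by gcongr
      _ = ε * d * L.length := by ring

end Tuple

/-! ### Union bound over window shapes, and the constant -/

namespace Tuple

variable {V : Type u} {b : ℕ} {M : Tuple V b}

/-- `Rel`-neighbours of `x` lie within distance two of `x`, where sparsity gives them distinct
parts. This makes the constant independent of `Δ`. -/
theorem maxDeg_rel_le {R : ℕ} (hR : 0 < R)
    (hπ : M.partition.IsSparse M.graph (3 * R)) :
    maxDeg (Rel M.graph) ≤ M.partition.parts.card := by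
  refine iSup_le fun x => ?_
  have hsub : nbhd (Rel M.graph) x ⊆ ball M.graph x (3 * R) := by
    have key : ∀ y, (Var M.graph x ∩ Var M.graph y).Nonempty → y ∈ ball M.graph x (3 * R) := by
      rintro y ⟨w, hx, hy⟩
      exact ball_mono x (by omega : 0 + 1 + 1 ≤ 3 * R)
        (mem_ball_succ (mem_ball_succ (mem_ball_self x 0) (Or.inl hx)) (Or.inr hy))
    rintro y (⟨w, hx, hy⟩ | ⟨w, hy, hx⟩)
    · exact key y ⟨w, hx, hy⟩
    · exact key y ⟨w, hx, hy⟩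
  rw [← ((hπ x).mono hsub).encard_image]
  refine (Set.encard_le_encard (Set.subset_univ _)).trans ?_
  rw [Set.encard_univ, ENat.card_eq_coe_fintype_card, Fintype.card_coe]

/-- The number of possible shapes of a window. -/
def numWindows (b d p : ℕ) : ℕ := (2 ^ p) ^ p * ((2 ^ b ^ p) ^ p * (d + 1) ^ p)

theorem measure_le_iSup_totalCount_le [NeZero b] {R d Δ m : ℕ} {δ ε : ℝ} (hR : 0 < R)
    (hε : 0 < ε) (hδ : 0 ≤ δ) (hΔ₀ : 0 < Δ) (hΔ : maxDeg (Rel M.graph) ≤ Δ)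
    (hG : IsSubexp M.graph R ε d) (hπ : M.partition.IsSparse M.graph (3 * R))
    (hq : ∀ x, M.rule.violationProb x ≤
      1 / ((Real.exp 1 * Δ) ^ (1 + δ) * (b : ℝ) ^ (ε * d)))
    (I : M.Source → ℕ → IndependenceFunction (Rel M.graph)) (hm : 2 ≤ m) :
    M.sourceMeasure {rnd | (m : ℕ∞) ≤ ⨆ x, M.totalCount (I rnd) rnd x} ≤
      ENNReal.ofReal (numWindows b d M.partition.parts.card *
        ((Real.exp 1 * Δ) ^ (δ * (1 - m)) * 2 ^ M.partition.parts.card)) := by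
  classical
  let P := M.partition.parts
  let Shape := (P → Finset P) × (P → Finset (P → Fin b)) × (P → Fin (d + 1))
  let Good : Shape → Set M.Source := fun σ => {rnd | ∃ L, Legal σ.1 σ.2.1 rnd L ∧
    m ≤ L.length + 1 ∧ ((L.map fun c => (σ.2.2 c : ℕ)).sum : ℝ) ≤ ε * d * L.length}
  -- The probability estimate is available only for shapes realised by an actual window of the
  -- graph.
  let Occurs : Shape → Prop := fun σ => ∃ x, ∃ i < R,
    σ.1 = M.windowVar (ball M.graph x (3 * R)) (ball M.graph x (3 * i)) ∧
    σ.2.1 = M.windowBad (ball M.graph x (3 * R)) (ball M.graph x (3 * i)) ∧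
    ∀ c, (σ.2.2 c : ℕ) = M.windowBoundary (ball M.graph x (3 * R)) (ball M.graph x (3 * i)) c
  have hsub : {rnd | (m : ℕ∞) ≤ ⨆ x, M.totalCount (I rnd) rnd x} ⊆
      ⋃ σ ∈ Finset.univ.filter Occurs, Good σ := by
    intro rnd h
    obtain ⟨x, i, hi, L, hL, hmL, hk⟩ := exists_legal_of_le_totalCount hR hε hG hπ hm h
    have hW := M.isWindow_ball hG hπ hi x
    exact Set.mem_biUnion (x := (M.windowVar (ball M.graph x (3 * R)) (ball M.graph x (3 * i)),
      M.windowBad (ball M.graph x (3 * R)) (ball M.graph x (3 * i)),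
      fun c => ⟨M.windowBoundary (ball M.graph x (3 * R)) (ball M.graph x (3 * i)) c,
        Nat.lt_succ_of_le (hW.windowBoundary_le hG.1 c)⟩))
      (Finset.mem_coe.2 (Finset.mem_filter.2 ⟨Finset.mem_univ _, x, i, hi, rfl, rfl, fun _ => rfl⟩))
      ⟨L, hL, hmL, hk⟩
  have hgood : ∀ σ ∈ Finset.univ.filter Occurs, M.sourceMeasure (Good σ) ≤
      ENNReal.ofReal ((Real.exp 1 * Δ) ^ (δ * (1 - m)) * 2 ^ M.partition.parts.card) := by
    rintro ⟨v, F, k⟩ hσ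
    obtain ⟨x, i, hi, hv, hF, hk⟩ := (Finset.mem_filter.1 hσ).2
    simp only at hv hF hk
    subst hv hF
    have hW := M.isWindow_ball hG hπ hi x
    let r : P → P → Prop := fun c c' => c = c' ∨
      ¬ Disjoint (M.windowVar (ball M.graph x (3 * R)) (ball M.graph x (3 * i)) c)
        (M.windowVar (ball M.graph x (3 * R)) (ball M.graph x (3 * i)) c')
    have : Std.Refl r := ⟨fun c => Or.inl rfl⟩
    have : Std.Symm r := ⟨fun c c' h => h.imp Eq.symm fun h h' => h h'.symm⟩
    have := tableMeasure_exists_legal_le (r := r)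
      (fun c c' h => not_not.1 fun h' => h (Or.inr h')) windowBad_congr hΔ₀
      (hW.card_reach_le hΔ₀ hΔ) (k := fun c => (k c : ℕ)) hδ (θ := ε * d) (fun c => by
        rw [hk c]
        exact hW.card_windowBad_div_le hG.1 (by positivity) hq c) m
    rwa [Fintype.card_coe] at this
  calc _ ≤ M.sourceMeasure (⋃ σ ∈ Finset.univ.filter Occurs, Good σ) := measure_mono hsub
    _ ≤ ∑ σ ∈ Finset.univ.filter Occurs, M.sourceMeasure (Good σ) :=
      measure_biUnion_finset_le _ _
    _ ≤ (Finset.univ.filter Occurs).card • ENNReal.ofReal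
        ((Real.exp 1 * Δ) ^ (δ * (1 - m)) * 2 ^ M.partition.parts.card) :=
      Finset.sum_le_card_nsmul _ _ _ hgood
    _ ≤ Fintype.card Shape • ENNReal.ofReal
        ((Real.exp 1 * Δ) ^ (δ * (1 - m)) * 2 ^ M.partition.parts.card) := by
      gcongr
      exact Finset.card_le_univ _
    _ = _ := by
      have : Fintype.card Shape = numWindows b d M.partition.parts.card := by
        simp [Shape, P, numWindows]
      rw [this, nsmul_eq_mul, ENNReal.ofReal_mul (Nat.cast_nonneg _), ENNReal.ofReal_natCast]

end Tuple

end MT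

/-- The independence functions may depend on the source of randomness and on the time. The bound is
a quotient of extended nonnegative reals, so that its right-hand side is `∞` when it has the form
`a / 0` with `a > 0` (which happens only if `Δ = 0` and `m > 0`). -/
theorem theorem2p1 (b : ℕ) (hb : 1 < b) (δ : ℝ) (hδ : 0 < δ) (d p : ℕ) :
    ∃ K : ℝ, 0 < K ∧
      ∀ (V : Type u) [Nonempty V] (M : MT.Tuple V b) (R : ℕ) (ε : ℝ) (Δ : ℕ),
        0 < R → 0 < ε →
        MT.maxDeg (MT.Rel M.graph) = Δ →
        MT.IsSubexp M.graph R ε d →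
        M.partition.IsSparse M.graph (3 * R) →
        M.partition.parts.card = p →
        (∀ x, M.rule.violationProb x ≤
          1 / ((Real.exp 1 * Δ) ^ (1 + δ) * (b : ℝ) ^ (ε * d))) →
        ∀ (I : M.Source → ℕ → MT.IndependenceFunction (MT.Rel M.graph)) (m : ℕ),
          M.sourceMeasure {rnd | (m : ℕ∞) ≤ ⨆ x, M.totalCount (I rnd) rnd x} ≤
            ENNReal.ofReal (K * (m + 1) ^ p) /
              ENNReal.ofReal ((Real.exp 1 * Δ) ^ (δ * m)) := by
  have : NeZero b := ⟨by omega⟩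
  have hN : (1 : ℝ) ≤ MT.Tuple.numWindows b d p := by
    have : 0 < MT.Tuple.numWindows b d p := by unfold MT.Tuple.numWindows; positivity
    exact_mod_cast this
  have h2 : (1 : ℝ) ≤ 2 ^ p := one_le_pow₀ one_le_two
  -- Since `n ≥ m - 1` rather than `m`, a factor `(eΔ) ^ δ` is left over, which `Δ ≤ p` bounds by
  -- `(e p) ^ δ`. The summand `1` ensures that the constant is at least one, as the case `m = 0`
  -- requires.
  refine ⟨MT.Tuple.numWindows b d p * ((1 + (Real.exp 1 * p) ^ δ) * 2 ^ p), by positivity, ?_⟩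
  intro V _ M R ε Δ hR hε hΔ hG hπ hp hq I m
  set K : ℝ := MT.Tuple.numWindows b d p * ((1 + (Real.exp 1 * p) ^ δ) * 2 ^ p) with hK
  have hK₀ : 0 < K := by positivity
  have := M.isProbabilityMeasure_sourceMeasure hb
  have hpow : (1 : ℝ) ≤ ((m : ℝ) + 1) ^ p := one_le_pow₀ (by simp)
  rcases Nat.eq_zero_or_pos m with rfl | hm
  · refine prob_le_one.trans ?_
    have hK₁ : 1 ≤ K := by
      have : 0 ≤ (Real.exp 1 * p) ^ δ := by positivity
      nlinarith [mul_nonneg this (zero_le_one.trans h2)]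
    simpa using hK₁
  rcases Nat.eq_zero_or_pos Δ with rfl | hΔ₀
  · have : (Real.exp 1 * ((0 : ℕ) : ℝ)) ^ (δ * m) = 0 := by
      rw [Nat.cast_zero, mul_zero, Real.zero_rpow (by positivity)]
    rw [this, ENNReal.ofReal_zero, ENNReal.div_zero (by
      simpa using (by positivity : 0 < K * ((m : ℝ) + 1) ^ p))]
    exact le_top
  have hρ₀ : 0 < Real.exp 1 * (Δ : ℝ) := by positivity
  have hΔp : Δ ≤ p := by
    have := MT.Tuple.maxDeg_rel_le hR hπ
    rwa [hΔ, hp, Nat.cast_le] at this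
  have hmain : M.sourceMeasure {rnd | (m : ℕ∞) ≤ ⨆ x, M.totalCount (I rnd) rnd x} ≤
      ENNReal.ofReal (MT.Tuple.numWindows b d p *
        ((Real.exp 1 * Δ) ^ (δ * (1 - m)) * 2 ^ p)) := by
    -- For `m = 1` the exponent `δ (1 - m)` vanishes and the bound is at least one.
    rcases (Nat.succ_le_of_lt hm).eq_or_lt with rfl | hm
    · refine prob_le_one.trans ?_
      rw [ENNReal.one_le_ofReal]
      simp only [Nat.succ_eq_add_one, zero_add, Nat.cast_one, sub_self, mul_zero, Real.rpow_zero,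
        one_mul]
      nlinarith
    · have := MT.Tuple.measure_le_iSup_totalCount_le hR hε hδ.le hΔ₀ hΔ.le hG hπ hq I hm
      rwa [hp] at this
  refine hmain.trans ?_
  rw [← ENNReal.ofReal_div_of_pos (by positivity)]
  refine ENNReal.ofReal_le_ofReal ?_
  have hδ' : (Real.exp 1 * (Δ : ℝ)) ^ δ ≤ 1 + (Real.exp 1 * p) ^ δ := by
    have : (Real.exp 1 * (Δ : ℝ)) ^ δ ≤ (Real.exp 1 * p) ^ δ := by gcongr
    linarith
  calc _ = MT.Tuple.numWindows b d p * ((Real.exp 1 * (Δ : ℝ)) ^ δ * 2 ^ p) /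
        (Real.exp 1 * (Δ : ℝ)) ^ (δ * m) := by
        rw [mul_sub, mul_one, Real.rpow_sub hρ₀]
        ring
    _ ≤ K / (Real.exp 1 * (Δ : ℝ)) ^ (δ * m) := by rw [hK]; gcongr
    _ ≤ _ := by
      gcongr
      exact le_mul_of_one_le_right hK₀.le hpow
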